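/- Let $G=\langle X\mid R\rangle$ be a group given by a finite presentation, where $R$ is a finite family of words on $X^{\pm1}$. Let $M(G)$ (the Miller machine of this presentation) be the group with generators $X$, a letter $\theta_\alpha$ for each $\alpha$ in the disjoint union $X\sqcup R$, and a further letter $q$, subject to the defining relations $$\theta_\alpha x=x\theta_\alpha\ \ (x\in X,\ \alpha\in X\sqcup R),\qquad \theta_x xq=qx\theta_x\ \ (x\in X),\qquad \theta_r q=qr\theta_r\ \ (r\in R).$$ Suppose that the conjugacy problem for $M(G)$ is solvable, i.e. there is an algorithm which decides, given two words on the generators of $M(G)$ and their inverses, whether they represent conjugate elements of $M(G)$. Then the cyclic subgroup membership problem for $G$ is solvable, i.e. there is an algorithm which decides, given two words $a,b$ on $X^{\pm1}$, whether there is an integer $m$ such that $b=a^m$ in $G$. -/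

import Mathlib

namespace Miller

/-- Words on `S ∪ S⁻¹`: the letter `(s, true)` is `s` and the letter `(s, false)` is `s⁻¹`.
Words need not be reduced. -/
abbrev Word (S : Type*) := List (S × Bool)

/-- The element of the group `⟨S | rels⟩` that a word represents. -/
def val {S : Type*} (rels : Set (FreeGroup S)) (w : Word S) : PresentedGroup rels :=
  PresentedGroup.mk rels (FreeGroup.mk w)

/-- The conjugacy problem of `⟨S | rels⟩` is solvable: there is an algorithm that decides, given
two words on the generators, whether they represent conjugate elements of the group.
(For a finite alphabet `S` this does not depend on the chosen coding of `S`.) -/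
def ConjugacyProblemSolvable {S : Type*} [Primcodable S] (rels : Set (FreeGroup S)) : Prop :=
  ComputablePred fun p : Word S × Word S => IsConj (val rels p.1) (val rels p.2)

/-- The cyclic subgroup membership problem of `⟨S | rels⟩` is solvable: there is an algorithm that
decides, given two words `a` and `b` on the generators, whether `b = a ^ m` in the group for some
integer `m`. -/
def CyclicSubgroupMembershipSolvable {S : Type*} [Primcodable S] (rels : Set (FreeGroup S)) :
    Prop :=
  ComputablePred fun p : Word S × Word S => ∃ m : ℤ, val rels p.2 = val rels p.1 ^ m

/-- The relators of `G = ⟨X | R⟩`, where the relators are given as a family of words. -/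
def groupRels {X ι : Type*} (R : ι → Word X) : Set (FreeGroup X) :=
  Set.range fun i => FreeGroup.mk (R i)

/-- The generators of the Miller machine: the letters of `X`, one letter `θ_α` for each `α` in the
disjoint union of `X` and the relators, and the letter `q`. -/
abbrev Gen (X ι : Type*) := X ⊕ (X ⊕ ι) ⊕ Unit

section Generators

variable {X ι : Type*}

/-- The letter `x ∈ X`, as a generator of the Miller machine. -/
def genX (x : X) : FreeGroup (Gen X ι) := FreeGroup.of (Sum.inl x)

/-- The letter `θ_α`. -/
def genθ (α : X ⊕ ι) : FreeGroup (Gen X ι) := FreeGroup.of (Sum.inr (Sum.inl α))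

/-- The letter `q`. -/
def genq : FreeGroup (Gen X ι) := FreeGroup.of (Sum.inr (Sum.inr ()))

/-- A word on `X`, read in the generators of the Miller machine. -/
def ofWord (w : Word X) : FreeGroup (Gen X ι) := FreeGroup.map Sum.inl (FreeGroup.mk w)

end Generators

/-- The defining relations of the Miller machine `M(G)` of `G = ⟨X | R⟩`; the relation `u = v` is
given by the relator `u * v⁻¹`. -/
inductive IsMillerRelator {X ι : Type*} (R : ι → Word X) : FreeGroup (Gen X ι) → Prop
  /-- `θ_α x = x θ_α` -/
  | comm (α : X ⊕ ι) (x : X) :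
      IsMillerRelator R ((genθ α * genX x) * (genX x * genθ α)⁻¹)
  /-- `θ_x x q = q x θ_x` -/
  | letter (x : X) :
      IsMillerRelator R
        ((genθ (Sum.inl x) * genX x * genq) * (genq * genX x * genθ (Sum.inl x))⁻¹)
  /-- `θ_r q = q r θ_r` -/
  | relator (i : ι) :
      IsMillerRelator R
        ((genθ (Sum.inr i) * genq) * (genq * ofWord (R i) * genθ (Sum.inr i))⁻¹)

/-- The relators of the Miller machine, so that `M(G) = PresentedGroup (millerRels R)`. -/
def millerRels {X ι : Type*} (R : ι → Word X) : Set (FreeGroup (Gen X ι)) :=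
  {w | IsMillerRelator R w}

end Miller

/-! Write F for the free group on X. In M(G) the letters θ centralize X, and products of them
conjugate q to α⁻¹qβ for exactly those pairs (α, β) in F × F with α = β in G. One inclusion is seen
in the semidirect product of F(X, q) by F × F, where θ_x acts as (x, x) and θ_r as (1, r)
(`toG_machineHom_fst`); the other holds because these pairs generate the fibre product
(`mem_twistSubgroup`).

Let u ≠ 1 in F have centralizer ⟨u⟩. Conjugating q u q⁻¹ u by such a product gives, up to conjugacy
in F(X, q), q(βuβ⁻¹)q⁻¹(αuα⁻¹). As q occurs once, this is conjugate to q(bub⁻¹)q⁻¹u only if α = uⁱ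
and β = buʲ, whence b = uⁱ⁻ʲ in G. Conversely, a solution of b = uᵐ in G supplies the pair (uᵐ, b).
So one conjugacy question decides whether b is a power of u in G (`isConj_of_toG_eq_zpow`,
`exists_toG_eq_zpow_of_isConj`).

An arbitrary a is replaced by u = a zᴺ w z⁻ᴺ, where w = 1 in G and N is large: it has the same value
in G and, if neither a nor w is a power of the letter z in F, its centralizer is ⟨u⟩
(`FreeGroup.mem_zpowers_of_commute_mul_conj`). This needs two letters and a nontrivial relator.
Otherwise G is free or finite cyclic, exponents can be bounded, and the word problem suffices; it is
decidable since qu is conjugate to q exactly when u = 1 in G. -/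

namespace FreeGroup

/-! ### Conjugacy of cyclically reduced words -/

variable {α : Type*}

theorem IsReduced.eq_of_mk_eq {L L' : List (α × Bool)} (hL : IsReduced L) (hL' : IsReduced L')
    (h : mk L = mk L') : L = L' := by
  classical
  rw [← hL.reduce_eq, ← hL'.reduce_eq]
  exact reduce.sound h

theorem IsReduced.append_of_last_head {L L' : List (α × Bool)} (hL : IsReduced L)
    (hL' : IsReduced L')
    (h : ∀ a ∈ L.getLast?, ∀ b ∈ L'.head?, a.1 = b.1 → a.2 = b.2) : IsReduced (L ++ L') :=
  List.isChain_append.2 ⟨hL, hL', h⟩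

theorem IsCyclicallyReduced.swap {L₁ L₂ : List (α × Bool)}
    (h : IsCyclicallyReduced (L₁ ++ L₂)) : IsCyclicallyReduced (L₂ ++ L₁) := by
  rcases eq_or_ne L₁ [] with rfl | h₁
  · simpa using h
  rcases eq_or_ne L₂ [] with rfl | h₂
  · simpa using h
  obtain ⟨a, ha⟩ := Option.ne_none_iff_exists'.1 (mt List.getLast?_eq_none_iff.1 h₁)
  obtain ⟨b, hb⟩ := Option.ne_none_iff_exists'.1 (mt List.getLast?_eq_none_iff.1 h₂)
  obtain ⟨c, hc⟩ := Option.ne_none_iff_exists'.1 (mt List.head?_eq_none_iff.1 h₁)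
  obtain ⟨d, hd⟩ := Option.ne_none_iff_exists'.1 (mt List.head?_eq_none_iff.1 h₂)
  obtain ⟨hr, hc'⟩ := h
  obtain ⟨hr₁, hr₂, hj⟩ := List.isChain_append.1 hr
  simp [List.getLast?_append, List.head?_append, ha, hb, hc, hd] at hc' hj
  refine ⟨List.isChain_append.2 ⟨hr₂, hr₁, ?_⟩, ?_⟩ <;>
    simpa [List.getLast?_append, List.head?_append, ha, hb, hc, hd]

/-- Conjugate cyclically reduced words are cyclic rotations of each other, and the conjugating
element is determined up to powers. -/
theorem exists_append_of_conj {L L' : List (α × Bool)} (hL : IsCyclicallyReduced L)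
    (hL' : IsCyclicallyReduced L') (hne : L ≠ []) (g : FreeGroup α)
    (h : g * mk L * g⁻¹ = mk L') :
    ∃ (L₁ L₂ : List (α × Bool)) (k : ℤ),
      L = L₁ ++ L₂ ∧ L' = L₂ ++ L₁ ∧ g = (mk L₁)⁻¹ * mk L ^ k := by
  classical
  obtain ⟨G, hG, rfl⟩ : ∃ G, IsReduced G ∧ mk G = g := ⟨g.toWord, isReduced_toWord, mk_toWord⟩
  -- If the last letter of the conjugator cancels against an end of `L`, conjugating by it merely
  -- rotates `L`, and the shorter conjugator remains.
  induction G using List.reverseRecOn generalizing L with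
  | nil =>
    refine ⟨[], L, 0, rfl, ?_, ?_⟩
    · rw [List.append_nil]
      exact (hL.isReduced.eq_of_mk_eq hL'.isReduced (by simpa [← one_eq_mk] using h)).symm
    · simp [← one_eq_mk]
  | append_singleton G x ih =>
    obtain ⟨x, e⟩ := x
    have hG₁ : IsReduced G := hG.infix ⟨[], [(x, e)], by simp⟩
    have hinv : mk [(x, !e)] = (mk [(x, e)])⁻¹ := by simp [inv_mk, invRev]
    by_cases hhead : L.head? = some (x, !e)
    · obtain ⟨L₀, rfl⟩ : ∃ L₀, L = (x, !e) :: L₀ := by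
        cases L with
        | nil => simp at hhead
        | cons a l => simp at hhead; exact ⟨l, by rw [hhead]⟩
      have hrot : mk (L₀ ++ [(x, !e)]) = mk [(x, e)] * mk ((x, !e) :: L₀) * (mk [(x, e)])⁻¹ := by
        rw [← mul_mk, ← List.singleton_append (l := L₀), ← mul_mk, hinv]; group
      obtain ⟨M₁, M₂, k, h₁, h₂, h₃⟩ := ih (L := L₀ ++ [(x, !e)])
        (IsCyclicallyReduced.swap (L₁ := [(x, !e)]) hL) (by simp)
        hG₁ (by rw [← h, hrot, ← mul_mk]; group)
      rw [hrot, conj_zpow] at h₃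
      rcases List.eq_nil_or_concat M₂ with rfl | ⟨M₂, y, rfl⟩
      · rw [List.append_nil] at h₁
        -- The rotated word was split trivially, so the rotation itself is the one-letter split of
        -- `L`; the extra letter costs one factor of `mk L`.
        refine ⟨[(x, !e)], L₀, k - 1, rfl, by rw [h₂, ← h₁]; simp, ?_⟩
        rw [← mul_mk, h₃, ← h₁, hrot, zpow_sub_one, hinv]
        generalize mk ((x, !e) :: L₀) = U
        have : U ^ k * U⁻¹ = U⁻¹ * U ^ k := by rw [← zpow_neg_one, ← zpow_add, ← zpow_add, add_comm]
        rw [this]; group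
      · rw [List.concat_eq_append] at h₁ h₂
        rw [← List.append_assoc] at h₁
        obtain ⟨h₄, h₅⟩ := List.append_inj' h₁ rfl
        simp only [List.cons.injEq, and_true] at h₅
        subst h₅ h₄
        refine ⟨(x, !e) :: M₁, M₂, k, rfl, by rw [h₂]; simp, ?_⟩
        rw [← mul_mk, h₃, ← List.singleton_append (l := M₁), ← mul_mk, hinv]
        group
    by_cases hlast : L.getLast? = some (x, e)
    · obtain ⟨L₀, rfl⟩ : ∃ L₀, L = L₀ ++ [(x, e)] := by
        rcases List.eq_nil_or_concat L with rfl | ⟨l, a, rfl⟩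
        · simp at hlast
        · simp at hlast; exact ⟨l, by simp [hlast]⟩
      have hrot : mk ((x, e) :: L₀) = mk [(x, e)] * mk (L₀ ++ [(x, e)]) * (mk [(x, e)])⁻¹ := by
        rw [← mul_mk, ← List.singleton_append, ← mul_mk]; group
      obtain ⟨M₁, M₂, k, h₁, h₂, h₃⟩ := ih (L := (x, e) :: L₀)
        hL.swap (by simp) hG₁ (by rw [← h, hrot, ← mul_mk (L₁ := G)]; group)
      rw [hrot, conj_zpow] at h₃
      cases M₁ with
      | nil =>
        rw [List.nil_append] at h₁
        refine ⟨L₀, [(x, e)], k + 1, rfl, by rw [h₂, ← h₁]; simp, ?_⟩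
        rw [← mul_mk, h₃, zpow_add_one, ← mul_mk]
        generalize hU : mk L₀ * mk [(x, e)] = U
        have : U ^ k * U = U * U ^ k := by rw [← zpow_add_one, add_comm, zpow_one_add]
        have hx : mk [(x, e)] = (mk L₀)⁻¹ * U := by rw [← hU]; group
        rw [this, ← one_eq_mk, hx]
        group
      | cons y M₁ =>
        simp only [List.cons_append, List.cons.injEq] at h₁
        obtain ⟨rfl, rfl⟩ := h₁
        refine ⟨M₁, M₂ ++ [(x, e)], k, by simp, by rw [h₂]; simp, ?_⟩
        rw [← mul_mk, h₃, ← List.singleton_append (l := M₁), ← mul_mk]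
        group
    · exfalso
      -- With no cancellation at either end the conjugate is reduced as written, hence is `L'`; but
      -- its first and last letters are mutually inverse.
      have hred : IsReduced (G ++ [(x, e)] ++ L ++ invRev (G ++ [(x, e)])) := by
        refine IsReduced.append_overlap ?_ ?_ hne
        · refine hG.append_of_last_head hL.isReduced ?_
          rintro a ha ⟨b, f⟩ hb
          simp only [List.getLast?_concat, Option.mem_def, Option.some.injEq] at ha hb
          subst ha
          rintro rfl
          by_contra hne'
          apply hhead
          rw [hb]
          simp only [Option.some.injEq, Prod.mk.injEq, true_and]
          cases e <;> cases f <;> simp_all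
        · refine hL.isReduced.append_of_last_head ?_ ?_
          · rw [isReduced_iff_reduce_eq, reduce_invRev, hG.reduce_eq]
          · rintro ⟨b, f⟩ hb a ha
            simp only [invRev_append, Option.mem_def] at ha hb
            simp [invRev] at ha
            subst ha
            rintro rfl
            by_contra hne'
            apply hlast
            rw [hb]
            simp only [Option.some.injEq, Prod.mk.injEq, true_and]
            cases e <;> cases f <;> simp_all
      have heq := hred.eq_of_mk_eq hL'.isReduced (by rw [← h, ← mul_mk, ← mul_mk, inv_mk])
      subst heq
      obtain ⟨⟨y, f⟩, G', hG'⟩ := List.exists_cons_of_ne_nil (l := G ++ [(x, e)]) (by simp)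
      rw [hG'] at hL'
      have := hL'.2 (y, !f) (by rw [invRev_cons, ← List.append_assoc]; exact List.getLast?_concat ..)
        (y, f) (by simp) rfl
      simp at this

/-- A rotation again starting with `c` must be trivial, since `c` occurs only once. -/
theorem eq_of_isConj_cons_of_notMem {L L' : List (α × Bool)} {c : α × Bool}
    (hL : IsCyclicallyReduced (c :: L)) (hL' : IsCyclicallyReduced (c :: L')) (hc : c ∉ L)
    (h : IsConj (mk (c :: L)) (mk (c :: L'))) : L = L' := by
  obtain ⟨g, hg⟩ := isConj_iff.1 h
  obtain ⟨L₁, L₂, -, h₁, h₂, -⟩ := exists_append_of_conj hL hL' (by simp) g hg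
  rcases L₁ with _ | ⟨x, L₁⟩
  · simpa using h₁.trans (h₂.trans (List.append_nil _)).symm
  rcases L₂ with _ | ⟨y, L₂⟩
  · simpa using ((h₂.trans (List.nil_append _)).trans (h₁.trans (List.append_nil _)).symm).symm
  simp only [List.cons_append, List.cons.injEq] at h₁ h₂
  rw [h₁.2, h₂.1] at hc
  simp at hc

/-! ### Splitting off powers of a letter -/

theorem mk_replicate (x : α) (n : ℕ) : mk (List.replicate n (x, true)) = of x ^ n := by
  induction n with
  | zero => simp [one_eq_mk]
  | succ n ih => rw [List.replicate_succ, pow_succ', ← ih, of, mul_mk]; rfl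

theorem mk_replicate_false (x : α) (n : ℕ) :
    mk (List.replicate n (x, false)) = (of x)⁻¹ ^ n := by
  rw [inv_pow, ← mk_replicate, inv_mk]; simp [invRev]

theorem exists_zpow_of_forall_fst_eq (z : α) (L : List (α × Bool)) (h : ∀ p ∈ L, p.1 = z) :
    ∃ i : ℤ, |i| ≤ L.length ∧ mk L = of z ^ i := by
  induction L with
  | nil => exact ⟨0, by simp, by simp [one_eq_mk]⟩
  | cons p L ih =>
    obtain ⟨i, hi, hL⟩ := ih fun q hq => h q (List.mem_cons_of_mem _ hq)
    obtain ⟨x, e⟩ := p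
    obtain rfl : x = z := h (x, e) (by simp)
    rw [abs_le] at hi
    rw [← List.singleton_append, ← mul_mk, hL]
    cases e
    · refine ⟨-1 + i, ?_, ?_⟩
      · simp only [List.singleton_append, List.length_cons, Nat.cast_add, Nat.cast_one]
        rw [abs_le]; omega
      · rw [zpow_add, zpow_neg_one, of, inv_mk]; rfl
    · refine ⟨1 + i, ?_, ?_⟩
      · simp only [List.singleton_append, List.length_cons, Nat.cast_add, Nat.cast_one]
        rw [abs_le]; omega
      · rw [zpow_add, zpow_one, of]

theorem exists_core (z : α) (g : FreeGroup α) (L : List (α × Bool)) (hL : mk L = g)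
    (hg : g ∉ Subgroup.zpowers (of z)) :
    ∃ (i j : ℤ) (A : List (α × Bool)), A ≠ [] ∧ IsReduced A ∧
      (∀ p ∈ A.head?, p.1 ≠ z) ∧ (∀ p ∈ A.getLast?, p.1 ≠ z) ∧
      |i| + |j| ≤ L.length ∧ A.length ≤ L.length ∧ g = of z ^ i * mk A * of z ^ j := by
  classical
  subst hL
  set W := reduce L with hW
  have hWr : IsReduced W := isReduced_iff_reduce_eq.2 reduce.idem
  have hmk : mk W = mk L := reduce.self
  have hlen : W.length ≤ L.length := norm_mk_le
  rw [← hmk] at hg ⊢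
  clear_value W
  let p : α × Bool → Bool := fun c => c.1 = z
  set B := W.takeWhile p
  set C := W.dropWhile p with hC
  have hBC : B ++ C = W := List.takeWhile_append_dropWhile
  set D := C.rtakeWhile p
  set A := C.rdropWhile p with hA
  have hAD : A ++ D = C := List.rdropWhile_append_rtakeWhile ..
  obtain ⟨i, hi, hBi⟩ := exists_zpow_of_forall_fst_eq z B fun q hq => by
    simpa [p] using List.mem_takeWhile_imp hq
  obtain ⟨j, hj, hDj⟩ := exists_zpow_of_forall_fst_eq z D fun q hq => by
    simpa [p] using List.mem_rtakeWhile_imp hq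
  have hl : B.length + (A.length + D.length) = W.length := by
    rw [← hBC, ← hAD]; simp
  have hgW : mk W = of z ^ i * mk A * of z ^ j := by
    rw [← hBC, ← hAD, ← mul_mk, ← mul_mk, hBi, hDj, mul_assoc]
  have hne : A ≠ [] := by
    intro h
    apply hg
    rw [hgW, h, ← one_eq_mk, mul_one, ← zpow_add]
    exact ⟨_, rfl⟩
  refine ⟨i, j, A, hne, ?_, ?_, ?_, by omega, by omega, hgW⟩
  · exact hWr.infix ⟨B, D, by rw [List.append_assoc, hAD, hBC]⟩
  · intro c hc
    have hc' : C.head? = some c := by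
      rw [← hAD, List.head?_append]
      simp only [Option.mem_def] at hc
      simp [hc]
    have := List.head?_dropWhile_not p W
    rw [← hC, hc'] at this
    simpa [p] using this
  · intro c hc
    have := List.rdropWhile_last_not p C hne
    rw [List.getLast?_eq_some_getLast hne] at hc
    simp only [Option.mem_def, Option.some.injEq] at hc
    simp only [← hA, hc] at this
    simpa [p] using this

end FreeGroup

/-! ### Elements that generate their own centralizer -/

namespace FreeGroup

variable {α : Type*}

theorem isReduced_replicate (n : ℕ) (c : α × Bool) : IsReduced (List.replicate n c) :=
  List.isChain_replicate_of_rel _ fun _ => rfl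

section RunWord

variable {z : α} {A W : List (α × Bool)} {P Q : ℕ}

theorem isCyclicallyReduced_runs (hP : P ≠ 0) (hQ : Q ≠ 0)
    (hA : IsReduced A) (hW : IsReduced W) (hA₀ : A ≠ []) (hW₀ : W ≠ [])
    (hAh : ∀ p ∈ A.head?, p.1 ≠ z) (hAl : ∀ p ∈ A.getLast?, p.1 ≠ z)
    (hWh : ∀ p ∈ W.head?, p.1 ≠ z) (hWl : ∀ p ∈ W.getLast?, p.1 ≠ z) :
    IsCyclicallyReduced
      ((List.replicate P (z, false) ++ A) ++ (List.replicate Q (z, true) ++ W)) := by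
  have h₁ : IsReduced (List.replicate P (z, false) ++ A) := by
    refine (isReduced_replicate _ _).append_of_last_head hA fun a ha b hb hab => ?_
    simp only [List.getLast?_replicate, hP, if_false, Option.mem_def, Option.some.injEq] at ha
    subst ha
    exact absurd hab.symm (hAh b hb)
  have h₂ : IsReduced (List.replicate Q (z, true) ++ W) := by
    refine (isReduced_replicate _ _).append_of_last_head hW fun a ha b hb hab => ?_
    simp only [List.getLast?_replicate, hQ, if_false, Option.mem_def, Option.some.injEq] at ha
    subst ha
    exact absurd hab.symm (hWh b hb)
  obtain ⟨l, hl⟩ := Option.ne_none_iff_exists'.1 (mt List.getLast?_eq_none_iff.1 hA₀)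
  obtain ⟨m, hm⟩ := Option.ne_none_iff_exists'.1 (mt List.getLast?_eq_none_iff.1 hW₀)
  refine ⟨h₁.append_of_last_head h₂ ?_, ?_⟩
  · intro a ha b hb hab
    simp [List.head?_replicate, List.getLast?_append, hl, hQ] at ha hb
    subst ha hb
    exact absurd hab (hAl _ hl)
  · intro a ha b hb hab
    simp [List.head?_replicate, List.getLast?_append, hm, hP] at ha hb
    subst ha hb
    exact absurd hab (hWl _ hm)

/-- A proper rotation fixing the word would make a second run of `z⁻¹` start inside it. That run is
too long to fit: depending on its start it meets the head of `A`, a letter of the run of `z`, or the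
last letter of `W`. -/
theorem eq_nil_or_eq_nil_of_runs_eq_append (hPA : A.length < P) (hPW : W.length ≤ P) (hQ : Q ≠ 0)
    (hA₀ : A ≠ []) (hW₀ : W ≠ [])
    (hAh : ∀ p ∈ A.head?, p.1 ≠ z) (hWl : ∀ p ∈ W.getLast?, p.1 ≠ z)
    {L₁ L₂ : List (α × Bool)}
    (h₁ : (List.replicate P (z, false) ++ A) ++ (List.replicate Q (z, true) ++ W) = L₁ ++ L₂)
    (h₂ : (List.replicate P (z, false) ++ A) ++ (List.replicate Q (z, true) ++ W) = L₂ ++ L₁) :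
    L₁ = [] ∨ L₂ = [] := by
  set U := (List.replicate P (z, false) ++ A) ++ (List.replicate Q (z, true) ++ W) with hU
  have hlen : U.length = P + A.length + (Q + W.length) := by simp [hU, add_assoc]
  have hlen' : U.length = L₁.length + L₂.length := by rw [h₁, List.length_append]
  have key : ∀ i, i < P → i < L₂.length → U[L₁.length + i]? = some (z, false) := by
    intro i hiP hi
    have h₃ : U[i]? = some (z, false) := by
      rw [hU, List.append_assoc, List.getElem?_append_left (by simpa using hiP)]
      simp [hiP]
    rw [← h₃]
    conv_lhs => rw [h₁]
    rw [h₂, List.getElem?_append_right (by omega), List.getElem?_append_left hi,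
      Nat.add_sub_cancel_left]
  have hA₁ : U[P]? = A.head? := by
    rw [hU, List.append_assoc, List.getElem?_append_right (by simp),
      List.getElem?_append_left (by simpa using List.length_pos_iff.2 hA₀),
      List.head?_eq_getElem?]
    simp
  have hQ₁ : ∀ i < Q, U[P + A.length + i]? = some (z, true) := by
    intro i hi
    rw [hU, List.getElem?_append_right (by simp), List.getElem?_append_left (by simp; omega)]
    simp [hi]
  have hW₁ : U[U.length - 1]? = W.getLast? := by
    rw [← List.getLast?_eq_getElem?, hU, ← List.append_assoc, List.getLast?_append_of_ne_nil _ hW₀]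
  have hApos := List.length_pos_iff.2 hA₀
  have hWpos := List.length_pos_iff.2 hW₀
  by_contra! hne
  have hL₁ := List.length_pos_iff.2 hne.1
  have hL₂ := List.length_pos_iff.2 hne.2
  rcases le_or_gt L₁.length P with hs | hs
  · have := key (P - L₁.length) (by omega) (by omega)
    rw [Nat.add_sub_cancel' hs, hA₁] at this
    exact hAh _ this rfl
  rcases le_or_gt L₁.length (P + A.length) with hs' | hs'
  · have := key (P + A.length - L₁.length) (by omega) (by omega)
    rw [Nat.add_sub_cancel' hs', ← add_zero (P + A.length), hQ₁ 0 (by omega)] at this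
    simp at this
  rcases lt_or_ge L₁.length (P + A.length + Q) with hs'' | hs''
  · have := key 0 (by omega) (by omega)
    rw [add_zero, ← Nat.add_sub_cancel' hs'.le, hQ₁ _ (by omega)] at this
    simp at this
  · have := key (U.length - 1 - L₁.length) (by omega) (by omega)
    rw [Nat.add_sub_cancel' (by omega), hW₁] at this
    exact hWl _ this rfl

end RunWord

/-- An element commuting with `mk U` conjugates `U` to itself, hence comes from a rotation fixing
`U`; the trivial rotations yield powers. -/
theorem mem_zpowers_of_commute_of_forall_append {U : List (α × Bool)} (hU : IsCyclicallyReduced U)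
    (hne : U ≠ []) (h : ∀ L₁ L₂, U = L₁ ++ L₂ → U = L₂ ++ L₁ → L₁ = [] ∨ L₂ = [])
    {v : FreeGroup α} (hv : Commute v (mk U)) : v ∈ Subgroup.zpowers (mk U) := by
  obtain ⟨L₁, L₂, k, h₁, h₂, h₃⟩ := exists_append_of_conj hU hU hne v
    (by rw [hv.eq, mul_inv_cancel_right])
  rcases h L₁ L₂ h₁ h₂ with rfl | rfl
  · exact ⟨k, by simp [h₃, ← one_eq_mk]⟩
  · rw [List.append_nil] at h₁
    subst h₁
    refine ⟨-1 + k, ?_⟩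
    simp only [h₃, zpow_add, zpow_neg_one]

/-- For words `a`, `w` that are not powers of the letter `z` and a long power `z ^ N`, the element
`a * z ^ N * w * z ^ (-N)` is not a proper power. -/
theorem mem_zpowers_of_commute_mul_conj {z : α} {a w : List (α × Bool)}
    (ha : mk a ∉ Subgroup.zpowers (of z)) (hw : mk w ∉ Subgroup.zpowers (of z)) {N : ℕ}
    (hN : 2 * (a.length + w.length) < N) :
    mk a * (of z ^ N * mk w * (of z ^ N)⁻¹) ≠ 1 ∧
    ∀ v, Commute v (mk a * (of z ^ N * mk w * (of z ^ N)⁻¹)) →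
      v ∈ Subgroup.zpowers (mk a * (of z ^ N * mk w * (of z ^ N)⁻¹)) := by
  obtain ⟨i, j, A, hA₀, hA, hAh, hAl, hij, hAlen, hgA⟩ := exists_core z _ a rfl ha
  obtain ⟨s, t, W, hW₀, hW, hWh, hWl, hst, hWlen, hgW⟩ := exists_core z _ w rfl hw
  have := abs_le.1 (le_refl |i|)
  have := abs_le.1 (le_refl |j|)
  have := abs_le.1 (le_refl |s|)
  have := abs_le.1 (le_refl |t|)
  -- With a = zⁱAzʲ and w = zˢWzᵗ, conjugating by zᵗ⁻ᴺ collects the outer powers of z in front: z⁻ᴾ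
  -- A z^Q W. The bound on `N` makes `P` exceed the lengths of `A` and `W`, and `Q` positive.
  obtain ⟨P, hP⟩ := Int.eq_ofNat_of_zero_le (a := (N : ℤ) - t - i) (by omega)
  obtain ⟨Q, hQ⟩ := Int.eq_ofNat_of_zero_le (a := j + N + s) (by omega)
  set u := mk a * (of z ^ N * mk w * (of z ^ N)⁻¹) with hu
  set U := (List.replicate P (z, false) ++ A) ++ (List.replicate Q (z, true) ++ W) with hUdef
  have hUu : mk U = MulAut.conj (of z ^ (t - N)) u := by
    rw [hUdef, ← mul_mk, ← mul_mk, ← mul_mk, mk_replicate, mk_replicate_false, MulAut.conj_apply,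
      hu, hgA, hgW, inv_pow, ← zpow_natCast, ← zpow_natCast (of z) Q, ← hP, ← hQ, ← zpow_natCast]
    group
  have hU₀ : U ≠ [] := by simp [hUdef, hA₀]
  have hUc : IsCyclicallyReduced U :=
    isCyclicallyReduced_runs (by omega) (by omega) hA hW hA₀ hW₀ hAh hAl hWh hWl
  constructor
  · intro h
    apply hU₀
    refine hUc.isReduced.eq_of_mk_eq IsReduced.nil ?_
    rw [hUu, h, ← one_eq_mk]
    exact _root_.map_one _
  · intro v hv
    have := mem_zpowers_of_commute_of_forall_append hUc hU₀
      (fun L₁ L₂ => eq_nil_or_eq_nil_of_runs_eq_append (by omega) (by omega) (by omega)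
        hA₀ hW₀ hAh hWl)
      (v := MulAut.conj (of z ^ (t - N)) v) (by rw [hUu]; exact hv.map _)
    obtain ⟨k, hk⟩ := this
    refine ⟨k, (MulAut.conj (of z ^ (t - N))).injective ?_⟩
    rw [← hk, hUu]
    exact map_zpow _ _ _

theorem natAbs_le_norm_zpow [DecidableEq α] {g : FreeGroup α} (hg : g ≠ 1) (m : ℤ) :
    m.natAbs ≤ norm (g ^ m) := by
  have key : ∀ n : ℕ, n ≤ norm (g ^ n) := by
    intro n
    have hne : reduceCyclically g.toWord ≠ [] := by
      intro h
      apply hg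
      have := reduceCyclically.conj_conjugator_reduceCyclically g.toWord
      rw [h, List.append_nil] at this
      rw [← mk_toWord (x := g), ← this, ← mul_mk, ← inv_mk, mul_inv_cancel]
    rcases n with _ | n
    · simp
    -- The nonempty cyclically reduced core is repeated without cancellation, each copy contributing
    -- at least one letter.
    · rw [norm, toWord_pow, reduceCyclically.reduce_flatten_replicate_succ isReduced_toWord]
      have := List.length_pos_iff.2 hne
      simp only [List.length_append, List.length_flatten, List.map_replicate, List.sum_replicate]
      simp only [smul_eq_mul]
      nlinarith
  obtain ⟨n, rfl | rfl⟩ := m.eq_nat_or_neg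
  · simpa using key n
  · simpa using key n

/-- A nontrivial normal subgroup of a free group of rank at least two contains elements outside the
cyclic subgroups generated by two given letters. -/
theorem exists_mem_notMem_zpowers {x y : α} (hxy : x ≠ y) {N : Subgroup (FreeGroup α)} [N.Normal]
    {r : FreeGroup α} (hr : r ∈ N) (hr₁ : r ≠ 1) :
    ∃ w ∈ N, w ∉ Subgroup.zpowers (of x) ∧ w ∉ Subgroup.zpowers (of y) := by
  classical
  have key : ∀ x y : α, x ≠ y → r ∈ Subgroup.zpowers (of x) →
      of y * r * (of y)⁻¹ ∉ Subgroup.zpowers (of x) ∧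
      of y * r * (of y)⁻¹ ∉ Subgroup.zpowers (of y) := by
    intro x y hxy hrx
    obtain ⟨s, rfl⟩ := Subgroup.mem_zpowers_iff.1 hrx
    have hs : s ≠ 0 := by
      rintro rfl
      simp at hr₁
    -- `e` is the exponent sum of `x`; `f` is the affine action on ℚ with `x` as t ↦ t + 1 and `y`
    -- as t ↦ 2t.
    let e : FreeGroup α →* Multiplicative ℤ := lift fun c => Multiplicative.ofAdd (if c = x then 1 else 0)
    let f : FreeGroup α →* Equiv.Perm ℚ :=
      lift fun c => if c = x then Equiv.addRight 1 else Equiv.mulLeft₀ 2 two_ne_zero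
    have hex : e (of x) = Multiplicative.ofAdd 1 := by simp [e]
    have hey : e (of y) = 1 := by simp [e, hxy.symm]
    have hfx : f (of x) = Equiv.addRight 1 := by simp [f]
    have hfy : f (of y) = Equiv.mulLeft₀ 2 two_ne_zero := by simp [f, hxy.symm]
    constructor
    · intro hk
      obtain ⟨k, hk⟩ := Subgroup.mem_zpowers_iff.1 hk
      have h₁ := congrArg e hk
      simp only [map_zpow, _root_.map_mul, _root_.map_inv, hex, hey, ← ofAdd_zsmul] at h₁
      have h₂ : k = s := by simpa using h₁
      subst h₂
      -- At 0, the power xᵏ gives k while yxᵏy⁻¹ gives 2k.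
      have h₃ := congrArg (fun p : Equiv.Perm ℚ => p 0) (congrArg f hk)
      simp only [map_zpow, _root_.map_mul, _root_.map_inv, hfx, hfy] at h₃
      simp at h₃
      exact hs (by exact_mod_cast (by linarith : (k : ℚ) = 0))
    · intro hk
      obtain ⟨k, hk⟩ := Subgroup.mem_zpowers_iff.1 hk
      have h₁ := congrArg e hk
      simp only [map_zpow, _root_.map_mul, _root_.map_inv, hex, hey, ← ofAdd_zsmul] at h₁
      exact hs (by simpa using h₁.symm)
  by_cases hx : r ∈ Subgroup.zpowers (of x)
  · exact ⟨_, Subgroup.Normal.conj_mem ‹_› r hr (of y), key x y hxy hx⟩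
  by_cases hy : r ∈ Subgroup.zpowers (of y)
  · exact ⟨_, Subgroup.Normal.conj_mem ‹_› r hr (of x), (key y x hxy.symm hy).symm⟩
  exact ⟨r, hr, hx, hy⟩

theorem eq_one_of_mem_zpowers_of_mem_zpowers {x y : α} (hxy : x ≠ y) {g : FreeGroup α}
    (hx : g ∈ Subgroup.zpowers (of x)) (hy : g ∈ Subgroup.zpowers (of y)) : g = 1 := by
  classical
  obtain ⟨i, rfl⟩ := hx
  obtain ⟨j, hj⟩ := hy
  let e : FreeGroup α →* Multiplicative ℤ := lift fun c => Multiplicative.ofAdd (if c = x then 1 else 0)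
  have h₁ := congrArg e hj
  simp only [map_zpow] at h₁
  have : i = 0 := by simpa [e, hxy.symm, ← ofAdd_zsmul] using h₁.symm
  simp [this]

theorem exists_eq_zpow_of_subsingleton [Subsingleton α] (x : α) (g : FreeGroup α) :
    ∃ i : ℤ, g = of x ^ i := by
  obtain ⟨i, -, hi⟩ := exists_zpow_of_forall_fst_eq x g.toWord fun p _ => Subsingleton.elim _ _
  exact ⟨i, by rw [← hi, mk_toWord]⟩

end FreeGroup

namespace Miller

/-! ### The action of F × F on F(X, q) -/

section Semidirect

variable {X : Type*}

/-- The inclusion of the free group on `X` into the free group on `X` and one more letter. -/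
abbrev emb : FreeGroup X →* FreeGroup (Option X) := FreeGroup.map some

/-- The additional letter of the free group on `Option X`. -/
abbrev newLetter (X : Type*) : FreeGroup (Option X) := FreeGroup.of none

/-- The endomorphism that fixes `X` and sends the additional letter `q` to `u * q * v`. -/
def twistHom (u v : FreeGroup X) : FreeGroup (Option X) →* FreeGroup (Option X) :=
  FreeGroup.lift fun o => o.elim (emb u * newLetter X * emb v) fun x => FreeGroup.of (some x)

theorem twistHom_newLetter (u v : FreeGroup X) :
    twistHom u v (newLetter X) = emb u * newLetter X * emb v := by
  simp [twistHom]

theorem twistHom_emb (u v w : FreeGroup X) : twistHom u v (emb w) = emb w := by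
  have : (twistHom u v).comp emb = emb := by
    ext x
    simp [twistHom]
  exact DFunLike.congr_fun this w

theorem twistHom_comp (u v u' v' : FreeGroup X) :
    (twistHom u v).comp (twistHom u' v') = twistHom (u' * u) (v * v') := by
  refine FreeGroup.ext_hom _ _ fun o => ?_
  cases o with
  | none =>
    change twistHom u v (twistHom u' v' (newLetter X)) = twistHom _ _ (newLetter X)
    rw [twistHom_newLetter, map_mul, map_mul, twistHom_emb, twistHom_emb, twistHom_newLetter,
      twistHom_newLetter, map_mul, map_mul]
    group
  | some x => simp [twistHom]

theorem twistHom_one : twistHom (1 : FreeGroup X) 1 = MonoidHom.id _ := by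
  refine FreeGroup.ext_hom _ _ fun o => ?_
  cases o <;> simp [twistHom]

/-- The action of pairs `(α, β)` on the free group on `X` and `q`, fixing `X` and sending `q` to
`α⁻¹ * q * β`. -/
def twist : FreeGroup X × FreeGroup X →* MulAut (FreeGroup (Option X)) where
  toFun p := (twistHom p.1⁻¹ p.2).toMulEquiv (twistHom p.1 p.2⁻¹)
    (by rw [twistHom_comp, inv_mul_cancel, inv_mul_cancel, twistHom_one])
    (by rw [twistHom_comp, mul_inv_cancel, mul_inv_cancel, twistHom_one])
  map_one' := by
    ext1 k
    change twistHom 1⁻¹ 1 k = k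
    rw [inv_one, twistHom_one, MonoidHom.id_apply]
  map_mul' p p' := by
    ext1 k
    change twistHom (p.1 * p'.1)⁻¹ (p.2 * p'.2) k = twistHom p.1⁻¹ p.2 (twistHom p'.1⁻¹ p'.2 k)
    rw [mul_inv_rev, ← twistHom_comp, MonoidHom.comp_apply]

theorem twist_newLetter (p : FreeGroup X × FreeGroup X) :
    twist p (newLetter X) = (emb p.1)⁻¹ * newLetter X * emb p.2 := by
  rw [← map_inv]
  exact twistHom_newLetter _ _

theorem twist_emb (p : FreeGroup X × FreeGroup X) (w : FreeGroup X) :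
    twist p (emb w) = emb w :=
  twistHom_emb _ _ _

theorem isReduced_map_some {L : List (X × Bool)} (h : FreeGroup.IsReduced L) :
    FreeGroup.IsReduced (L.map fun p => (some p.1, p.2)) :=
  (List.isChain_map _).2 (h.imp fun _ _ hab h => hab (Option.some_injective _ h))

theorem fst_ne_none_of_mem {L : List (X × Bool)} {c : Option X × Bool}
    (h : c ∈ L.map fun p => (some p.1, p.2)) : c.1 ≠ none := by
  obtain ⟨p, -, rfl⟩ := List.mem_map.1 h
  simp

theorem emb_mk (L : List (X × Bool)) :
    emb (FreeGroup.mk L) = FreeGroup.mk (L.map fun p => (some p.1, p.2)) :=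
  FreeGroup.map.mk

theorem newLetter_mul_mk (L : List (Option X × Bool)) :
    newLetter X * FreeGroup.mk L = FreeGroup.mk ((none, true) :: L) := by
  rw [newLetter, FreeGroup.of, FreeGroup.mul_mk]; rfl

theorem newLetter_inv_mul_mk (L : List (Option X × Bool)) :
    (newLetter X)⁻¹ * FreeGroup.mk L = FreeGroup.mk ((none, false) :: L) := by
  rw [newLetter, FreeGroup.of, FreeGroup.inv_mk, FreeGroup.mul_mk]; rfl

theorem map_some_injective :
    Function.Injective (List.map fun p : X × Bool => ((some p.1, p.2) : Option X × Bool)) :=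
  List.map_injective_iff.2 fun p p' h => by
    simpa [Prod.ext_iff] using h

theorem eq_of_isConj_newLetter_mul_emb {c c' : FreeGroup X}
    (h : IsConj (newLetter X * emb c) (newLetter X * emb c')) : c = c' := by
  classical
  have key : ∀ c : FreeGroup X, FreeGroup.IsCyclicallyReduced
      ((none, true) :: c.toWord.map fun p => (some p.1, p.2)) := by
    intro c
    refine ⟨FreeGroup.IsReduced.append_of_last_head (L := [(none, true)]) .singleton
      (isReduced_map_some FreeGroup.isReduced_toWord) ?_, ?_⟩
    · intro a ha b hb hab
      simp only [List.getLast?_singleton, Option.mem_def, Option.some.injEq] at ha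
      subst ha
      exact absurd hab.symm (fst_ne_none_of_mem (List.mem_of_mem_head? hb))
    · intro a ha b hb hab
      rw [List.getLast?_cons] at ha
      simp at ha hb
      subst hb ha
      cases h : c.toWord.getLast? with
      | none => simp
      | some p => simp [h] at hab
  rw [← FreeGroup.mk_toWord (x := c), ← FreeGroup.mk_toWord (x := c'), emb_mk, emb_mk,
    newLetter_mul_mk, newLetter_mul_mk] at h
  exact FreeGroup.toWord_injective (map_some_injective
    (FreeGroup.eq_of_isConj_cons_of_notMem (key c) (key c') (by simp) h))

/-- Nontriviality of all four elements makes both words cyclically reduced. Each contains the letter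
q once, so they coincide, and the unique q⁻¹ separates the two factors. -/
theorem eq_of_isConj_newLetter_mul_mul_inv_mul {c d c' d' : FreeGroup X}
    (hc : c ≠ 1) (hd : d ≠ 1) (hc' : c' ≠ 1) (hd' : d' ≠ 1)
    (h : IsConj (newLetter X * emb c * (newLetter X)⁻¹ * emb d)
      (newLetter X * emb c' * (newLetter X)⁻¹ * emb d')) : c = c' ∧ d = d' := by
  classical
  let word (c d : FreeGroup X) : List (Option X × Bool) :=
    (c.toWord.map fun p => (some p.1, p.2)) ++ (none, false) :: d.toWord.map fun p => (some p.1, p.2)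
  have hmk : ∀ c d : FreeGroup X, newLetter X * emb c * (newLetter X)⁻¹ * emb d =
      FreeGroup.mk ((none, true) :: word c d) := by
    intro c d
    rw [← newLetter_mul_mk, ← FreeGroup.mul_mk, ← newLetter_inv_mul_mk, ← emb_mk, ← emb_mk,
      FreeGroup.mk_toWord, FreeGroup.mk_toWord]
    group
  have key : ∀ c d : FreeGroup X, c ≠ 1 → d ≠ 1 →
      FreeGroup.IsCyclicallyReduced ((none, true) :: word c d) := by
    intro c d hc hd
    obtain ⟨l, hl⟩ := Option.ne_none_iff_exists'.1
      (mt (List.getLast?_eq_none_iff.trans FreeGroup.toWord_eq_nil_iff).1 hc)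
    obtain ⟨m, hm⟩ := Option.ne_none_iff_exists'.1
      (mt (List.getLast?_eq_none_iff.trans FreeGroup.toWord_eq_nil_iff).1 hd)
    obtain ⟨n, hn⟩ := Option.ne_none_iff_exists'.1
      (mt (List.head?_eq_none_iff.trans FreeGroup.toWord_eq_nil_iff).1 hc)
    have h₁ : FreeGroup.IsReduced
        ((none, false) :: d.toWord.map fun p => ((some p.1, p.2) : Option X × Bool)) := by
      refine FreeGroup.IsReduced.append_of_last_head (L := [(none, false)]) .singleton
        (isReduced_map_some FreeGroup.isReduced_toWord) ?_
      intro a ha b hb hab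
      simp only [List.getLast?_singleton, Option.mem_def, Option.some.injEq] at ha
      subst ha
      exact absurd hab.symm (fst_ne_none_of_mem (List.mem_of_mem_head? hb))
    have h₂ : FreeGroup.IsReduced (word c d) := by
      refine (isReduced_map_some FreeGroup.isReduced_toWord).append_of_last_head h₁ ?_
      intro a ha b hb hab
      simp [hl] at ha hb
      subst ha hb
      simp at hab
    refine ⟨FreeGroup.IsReduced.append_of_last_head (L := [(none, true)]) .singleton h₂ ?_, ?_⟩
    · intro a ha b hb hab
      simp [hn] at ha hb
      subst ha hb
      simp at hab
    · intro a ha b hb hab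
      simp [word, List.getLast?_cons, List.getLast?_append, hm] at ha hb
      subst ha hb
      simp at hab
  rw [hmk, hmk] at h
  have h₃ : word c d = word c' d' :=
    FreeGroup.eq_of_isConj_cons_of_notMem (key c d hc hd) (key c' d' hc' hd') (by simp [word]) h
  have h₄ := List.append_cons_inj_of_notMem (by simp) (by simp) |>.1 h₃
  exact ⟨FreeGroup.toWord_injective (map_some_injective h₄.1),
    FreeGroup.toWord_injective (map_some_injective h₄.2.2)⟩

end Semidirect

/-! ### Conjugacy in the Miller machine -/

section Machine

variable {X ι : Type*} (R : ι → Word X)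

/-- The value in `G` of an element of the free group on `X`. -/
abbrev toG : FreeGroup X →* PresentedGroup (groupRels R) := PresentedGroup.mk _

/-- The value in the Miller machine of an element of the free group on `X`. -/
abbrev toM : FreeGroup X →* PresentedGroup (millerRels R) :=
  (PresentedGroup.mk _).comp (FreeGroup.map Sum.inl)

/-- The letter `q` in the Miller machine. -/
abbrev qM : PresentedGroup (millerRels R) := PresentedGroup.mk _ genq

theorem toG_relator (i : ι) : toG R (FreeGroup.mk (R i)) = 1 :=
  PresentedGroup.one_of_mem ⟨i, rfl⟩

/-- The images of the letters of the Miller machine in a semidirect product. -/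
def machineLetter : Gen X ι → FreeGroup (Option X) ⋊[twist] (FreeGroup X × FreeGroup X)
  | Sum.inl x => SemidirectProduct.inl (FreeGroup.of (some x))
  | Sum.inr (Sum.inl (Sum.inl x)) => SemidirectProduct.inr (FreeGroup.of x, FreeGroup.of x)
  | Sum.inr (Sum.inl (Sum.inr i)) => SemidirectProduct.inr (1, FreeGroup.mk (R i))
  | Sum.inr (Sum.inr ()) => SemidirectProduct.inl (newLetter X)

theorem lift_machineLetter_map (w : FreeGroup X) :
    FreeGroup.lift (machineLetter R) (FreeGroup.map Sum.inl w) =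
      SemidirectProduct.inl (emb w) := by
  have : (FreeGroup.lift (machineLetter R)).comp (FreeGroup.map Sum.inl) =
      SemidirectProduct.inl.comp emb := by
    ext1 x
    simp [machineLetter]
  exact DFunLike.congr_fun this w

theorem inr_mul_inl (t : FreeGroup X × FreeGroup X) (k : FreeGroup (Option X)) :
    (SemidirectProduct.inr t * SemidirectProduct.inl k :
      FreeGroup (Option X) ⋊[twist] (FreeGroup X × FreeGroup X)) =
    SemidirectProduct.inl (twist t k) * SemidirectProduct.inr t := by
  rw [SemidirectProduct.inl_aut, mul_assoc, ← map_mul, inv_mul_cancel, map_one, mul_one]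

/-- The Miller machine maps to the semidirect product of the free group on `X` and `q` by pairs of
elements of the free group on `X`. -/
def machineHom : PresentedGroup (millerRels R) →*
    FreeGroup (Option X) ⋊[twist] (FreeGroup X × FreeGroup X) :=
  PresentedGroup.toGroup (f := machineLetter R) (by
    have hX (x : X) : FreeGroup.lift (machineLetter R) (genX x) =
      SemidirectProduct.inl (emb (FreeGroup.of x)) := by simp [machineLetter, genX]
    have hq : FreeGroup.lift (machineLetter R) genq = SemidirectProduct.inl (newLetter X) := by
      simp [machineLetter, genq]
    have hθ (a : X ⊕ ι) : ∃ t, FreeGroup.lift (machineLetter R) (genθ a) =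
        SemidirectProduct.inr t := by
      cases a <;> exact ⟨_, FreeGroup.lift_apply_of ..⟩
    rintro r (⟨a, x⟩ | ⟨x⟩ | ⟨i⟩)
    · obtain ⟨t, ht⟩ := hθ a
      rw [map_mul, map_inv, mul_inv_eq_one, map_mul, map_mul, hX, ht, inr_mul_inl, twist_emb]
    · have ht : FreeGroup.lift (machineLetter R) (genθ (Sum.inl x)) =
        SemidirectProduct.inr (FreeGroup.of x, FreeGroup.of x) := FreeGroup.lift_apply_of ..
      rw [map_mul, map_inv, mul_inv_eq_one, map_mul, map_mul, map_mul, map_mul, hX, hq, ht,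
        mul_assoc, ← map_mul, inr_mul_inl, map_mul (twist _), twist_emb, twist_newLetter,
        ← map_mul SemidirectProduct.inl]
      congr 2
      group
    · have ht : FreeGroup.lift (machineLetter R) (genθ (Sum.inr i)) =
        SemidirectProduct.inr (1, FreeGroup.mk (R i)) := FreeGroup.lift_apply_of ..
      rw [map_mul, map_inv, mul_inv_eq_one, map_mul, map_mul, map_mul, hq, ht, inr_mul_inl,
        twist_newLetter, ofWord, lift_machineLetter_map, ← map_mul SemidirectProduct.inl]
      simp)

theorem machineHom_toM (w : FreeGroup X) :
    machineHom R (toM R w) = SemidirectProduct.inl (emb w) :=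
  lift_machineLetter_map R w

theorem machineHom_qM : machineHom R (qM R) = SemidirectProduct.inl (newLetter X) :=
  PresentedGroup.toGroup.of _

theorem toG_machineHom_fst (m : PresentedGroup (millerRels R)) :
    toG R (machineHom R m).right.1 = toG R (machineHom R m).right.2 := by
  have : (((toG R).comp (MonoidHom.fst _ _)).comp SemidirectProduct.rightHom).comp (machineHom R) =
      (((toG R).comp (MonoidHom.snd _ _)).comp SemidirectProduct.rightHom).comp (machineHom R) := by
    refine PresentedGroup.ext fun g => ?_
    rcases g with x | (x | i) | _ <;>
      simp [machineHom, machineLetter, PresentedGroup.toGroup.of]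
    exact (toG_relator R i).symm
  exact DFunLike.congr_fun this m

/-- The image of a conjugator factors as an element of F(X, q) times a pair in the fibre product. -/
theorem exists_isConj_twist_of_isConj {m m' : PresentedGroup (millerRels R)}
    {k k' : FreeGroup (Option X)} (hm : machineHom R m = SemidirectProduct.inl k)
    (hm' : machineHom R m' = SemidirectProduct.inl k') (h : IsConj m m') :
    ∃ p : FreeGroup X × FreeGroup X, toG R p.1 = toG R p.2 ∧ IsConj (twist p k) k' := by
  obtain ⟨g, hg⟩ := isConj_iff.1 h
  refine ⟨_, toG_machineHom_fst R g, isConj_iff.2 ⟨(machineHom R g).left, ?_⟩⟩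
  apply SemidirectProduct.inl_injective (φ := twist)
  have h₁ := SemidirectProduct.inl_left_mul_inr_right (machineHom R g)
  rw [← hm', ← hg, map_mul (machineHom R), map_mul (machineHom R), map_inv (machineHom R), hm,
    map_mul, map_mul, map_inv, SemidirectProduct.inl_aut, map_inv]
  conv_rhs => rw [← h₁]
  group

/-- The pairs `(α, β)` for which some element of the Miller machine centralizes `X` and conjugates
`q` to `α⁻¹ * q * β`. -/
def twistSubgroup : Subgroup (FreeGroup X × FreeGroup X) where
  carrier := {p | ∃ t : PresentedGroup (millerRels R),
    (∀ w, MulAut.conj t (toM R w) = toM R w) ∧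
      MulAut.conj t (qM R) = (toM R p.1)⁻¹ * qM R * toM R p.2}
  mul_mem' := by
    rintro p p' ⟨t, ht, hq⟩ ⟨t', ht', hq'⟩
    refine ⟨t * t', fun w => ?_, ?_⟩
    · rw [map_mul, MulAut.mul_apply, ht', ht]
    · rw [map_mul, MulAut.mul_apply, hq', map_mul, map_mul, map_inv, ht, ht, hq, Prod.fst_mul,
        Prod.snd_mul, map_mul, map_mul]
      group
  one_mem' := ⟨1, by simp⟩
  inv_mem' := by
    rintro p ⟨t, ht, hq⟩
    have key : ∀ m m', MulAut.conj t m' = m → MulAut.conj t⁻¹ m = m' := by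
      rintro _ m' rfl
      rw [map_inv, MulAut.inv_apply_self]
    refine ⟨t⁻¹, fun w => key _ _ (ht w), key _ _ ?_⟩
    rw [map_mul, map_mul, map_inv, ht, ht, hq, Prod.fst_inv, Prod.snd_inv, map_inv, map_inv]
    group

/-- The fibre product is generated by the diagonal, coming from the θ_x, and by the pairs (1, n)
with n = 1 in G, coming from the θ_r. -/
theorem mem_twistSubgroup {α β : FreeGroup X} (h : toG R α = toG R β) :
    (α, β) ∈ twistSubgroup R := by
  have hcomm : ∀ (a : X ⊕ ι) (w : FreeGroup X),
      MulAut.conj (PresentedGroup.mk (millerRels R) (genθ a)) (toM R w) = toM R w := by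
    intro a w
    have : ((MulAut.conj (PresentedGroup.mk (millerRels R) (genθ a))).toMonoidHom).comp (toM R) =
        toM R := by
      ext x
      have := PresentedGroup.one_of_mem (rels := millerRels R) (IsMillerRelator.comm a x)
      rw [map_mul, map_inv, mul_inv_eq_one, map_mul, map_mul] at this
      simp only [MonoidHom.comp_apply, MulEquiv.coe_toMonoidHom, MulAut.conj_apply,
        FreeGroup.map.of]
      exact mul_inv_eq_of_eq_mul this
    exact DFunLike.congr_fun this w
  have hdiag : ∀ f : FreeGroup X, (f, f) ∈ twistSubgroup R := by
    intro f
    induction f using FreeGroup.induction_on with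
    | C1 => exact one_mem (twistSubgroup R)
    | of x =>
      refine ⟨_, hcomm (Sum.inl x), ?_⟩
      have := PresentedGroup.one_of_mem (rels := millerRels R) (IsMillerRelator.letter x)
      have hc := hcomm (Sum.inl x) (FreeGroup.of x)
      rw [map_mul, map_inv, mul_inv_eq_one, map_mul, map_mul, map_mul, map_mul] at this
      rw [MulAut.conj_apply, mul_inv_eq_iff_eq_mul] at hc ⊢
      have hg : toM R (FreeGroup.of x) = PresentedGroup.mk (millerRels R) (genX x) := by
        simp [genX]
      rw [hg] at hc ⊢
      rw [hc] at this
      rw [mul_assoc (_⁻¹ * _), mul_assoc, eq_inv_mul_iff_mul_eq, ← mul_assoc, this, mul_assoc]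
    | inv_of x hx => exact inv_mem (S := Subgroup _) hx
    | mul f g hf hg => exact mul_mem (S := Subgroup _) hf hg
  let N : Subgroup (FreeGroup X) := (twistSubgroup R).comap (MonoidHom.inr _ _)
  -- Conjugating (1, n) by the diagonal pair (f, f) gives (1, fnf⁻¹).
  have hN : N.Normal := by
    refine ⟨fun n hn f => ?_⟩
    have := mul_mem (mul_mem (hdiag f) hn) (inv_mem (hdiag f))
    simpa [N] using this
  have hrel : Subgroup.normalClosure (groupRels R) ≤ N := by
    refine Subgroup.normalClosure_le_normal ?_
    rintro _ ⟨i, rfl⟩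
    refine ⟨_, hcomm (Sum.inr i), ?_⟩
    have := PresentedGroup.one_of_mem (rels := millerRels R) (IsMillerRelator.relator i)
    rw [map_mul, map_inv, mul_inv_eq_one, map_mul, map_mul, map_mul] at this
    rw [MulAut.conj_apply, mul_inv_eq_iff_eq_mul, this]
    simp [ofWord]
  have hβ : β * α⁻¹ ∈ N := hrel (PresentedGroup.mk_eq_one_iff.1 (by
    rw [map_mul, map_inv, mul_inv_eq_one]; exact h.symm))
  have := mul_mem (show ((1 : FreeGroup X), β * α⁻¹) ∈ twistSubgroup R from hβ) (hdiag α)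
  simpa using this

/-- This reduces the word problem of G to conjugacy: up to conjugacy a pair (α, β) turns qu into
qβuα⁻¹, which is conjugate to q only if βuα⁻¹ = 1. -/
theorem isConj_qM_mul_iff (u : FreeGroup X) :
    IsConj (qM R * toM R u) (qM R) ↔ toG R u = 1 := by
  constructor
  · intro h
    obtain ⟨p, hp, hc⟩ := exists_isConj_twist_of_isConj R (k := newLetter X * emb u)
      (by rw [map_mul, machineHom_qM, machineHom_toM, map_mul]) (machineHom_qM R) h
    have hc' : IsConj (newLetter X * emb (p.2 * u * p.1⁻¹)) (newLetter X * emb 1) := by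
      rw [map_one, mul_one]
      refine IsConj.trans (isConj_iff.2 ⟨(emb p.1)⁻¹, ?_⟩) hc
      simp only [map_mul, map_inv, twist_newLetter, twist_emb]
      group
    have := congrArg (toG R) (eq_of_isConj_newLetter_mul_emb hc')
    rw [map_mul, map_mul, map_inv, ← hp, map_one, mul_inv_eq_one] at this
    simpa using this
  · intro h
    obtain ⟨t, -, hq⟩ := mem_twistSubgroup R (α := 1) (β := u) (by rw [h, map_one])
    refine IsConj.symm (isConj_iff.2 ⟨t, ?_⟩)
    rw [← MulAut.conj_apply, hq]
    simp

theorem isConj_of_toG_eq_zpow {u b : FreeGroup X} {m : ℤ} (h : toG R b = toG R u ^ m) :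
    IsConj (qM R * toM R u * (qM R)⁻¹ * toM R u)
      (qM R * toM R (b * u * b⁻¹) * (qM R)⁻¹ * toM R u) := by
  obtain ⟨t, ht, hq⟩ := mem_twistSubgroup R (α := u ^ m) (β := b) (by rw [h, map_zpow])
  -- `t` produces u⁻ᵐ(q bub⁻¹ q⁻¹)uᵐu; the factor uᵐ removes the outer powers.
  refine isConj_iff.2 ⟨toM R (u ^ m) * t, ?_⟩
  rw [← MulAut.conj_apply, map_mul MulAut.conj, MulAut.mul_apply]
  simp only [map_mul (MulAut.conj t), map_inv (MulAut.conj t), ht, hq]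
  rw [MulAut.conj_apply, map_mul (toM R), map_mul (toM R), map_inv, map_zpow]
  group

theorem exists_toG_eq_zpow_of_isConj {u b : FreeGroup X} (hu : u ≠ 1)
    (hcent : ∀ v, Commute v u → v ∈ Subgroup.zpowers u)
    (h : IsConj (qM R * toM R u * (qM R)⁻¹ * toM R u)
      (qM R * toM R (b * u * b⁻¹) * (qM R)⁻¹ * toM R u)) :
    ∃ m : ℤ, toG R b = toG R u ^ m := by
  obtain ⟨⟨α, β⟩, hp, hc⟩ := exists_isConj_twist_of_isConj R
    (k := newLetter X * emb u * (newLetter X)⁻¹ * emb u)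
    (k' := newLetter X * emb (b * u * b⁻¹) * (newLetter X)⁻¹ * emb u)
    (by simp only [map_mul, map_inv, machineHom_qM, machineHom_toM])
    (by simp only [map_mul (machineHom R), map_inv (machineHom R), machineHom_qM, machineHom_toM,
      map_mul SemidirectProduct.inl, map_inv SemidirectProduct.inl]) h
  have hc' : IsConj (newLetter X * emb (β * u * β⁻¹) * (newLetter X)⁻¹ * emb (α * u * α⁻¹))
      (newLetter X * emb (b * u * b⁻¹) * (newLetter X)⁻¹ * emb u) := by
    refine IsConj.trans (isConj_iff.2 ⟨(emb α)⁻¹, ?_⟩) hc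
    simp only [map_mul, map_inv, twist_newLetter, twist_emb]
    group
  have hne : ∀ g : FreeGroup X, g * u * g⁻¹ ≠ 1 := fun g => by rwa [Ne, conj_eq_one_iff]
  obtain ⟨h₁, h₂⟩ := eq_of_isConj_newLetter_mul_mul_inv_mul (hne β) (hne α) (hne b) hu hc'
  obtain ⟨i, hi⟩ := hcent α (mul_inv_eq_iff_eq_mul.1 h₂)
  obtain ⟨j, hj⟩ := hcent (b⁻¹ * β) (by
    have : β * u = b * u * b⁻¹ * β := mul_inv_eq_iff_eq_mul.1 h₁
    rw [commute_iff_eq, mul_assoc, this]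
    group)
  refine ⟨i - j, ?_⟩
  have hb : b = β * (u ^ j)⁻¹ := by
    simp only at hj
    rw [hj]; group
  simp only at hi hp
  rw [hb, map_mul, ← hp, ← hi, map_inv, map_zpow, map_zpow, zpow_sub]

end Machine

end Miller

/-! ### Closure properties of decidable predicates -/

namespace ComputablePred

variable {α β : Type*} [Primcodable α] [Primcodable β]

theorem comp {p : β → Prop} (hp : ComputablePred p) {f : α → β} (hf : Computable f) :
    ComputablePred fun a => p (f a) :=
  computable_of_manyOneReducible ⟨f, hf, fun _ => Iff.rfl⟩ hp

theorem and {p q : α → Prop} (hp : ComputablePred p) (hq : ComputablePred q) :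
    ComputablePred fun a => p a ∧ q a := by
  obtain ⟨f, hf, rfl⟩ := computable_iff.1 hp
  obtain ⟨g, hg, rfl⟩ := computable_iff.1 hq
  exact computable_iff.2 ⟨fun a => f a && g a, Primrec.and.to_comp.comp hf hg, by simp⟩

theorem or {p q : α → Prop} (hp : ComputablePred p) (hq : ComputablePred q) :
    ComputablePred fun a => p a ∨ q a := by
  obtain ⟨f, hf, rfl⟩ := computable_iff.1 hp
  obtain ⟨g, hg, rfl⟩ := computable_iff.1 hq
  exact computable_iff.2 ⟨fun a => f a || g a, Primrec.or.to_comp.comp hf hg, by simp⟩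

theorem exists_lt {p : α → ℕ → Prop} (hp : ComputablePred fun x : α × ℕ => p x.1 x.2) {f : α → ℕ}
    (hf : Computable f) : ComputablePred fun a => ∃ n < f a, p a n := by
  obtain ⟨g, hg, hpg⟩ := computable_iff.1 hp
  have hpg' : ∀ a n, p a n ↔ g (a, n) = true := fun a n => iff_of_eq (congrFun hpg (a, n))
  refine computable_iff.2 ⟨_, Computable.nat_rec (h := fun a y => y.2 || g (a, y.1)) hf
    (Computable.const false) ?_, ?_⟩
  · exact Primrec.or.to_comp.comp (Computable.snd.comp Computable.snd)
      (hg.comp (Computable.fst.pair (Computable.fst.comp Computable.snd)))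
  · funext a
    simp only [hpg', eq_iff_iff]
    induction f a with
    | zero => simp
    | succ n ih =>
      simp only [Bool.or_eq_true, ← ih]
      constructor
      · rintro ⟨k, hk, h⟩
        rcases Nat.lt_succ_iff_lt_or_eq.1 hk with hk | rfl
        · exact Or.inl ⟨k, hk, h⟩
        · exact Or.inr h
      · rintro (⟨k, hk, h⟩ | h)
        · exact ⟨k, hk.trans n.lt_succ_self, h⟩
        · exact ⟨n, n.lt_succ_self, h⟩

end ComputablePred

namespace Miller

/-! ### Primitive recursive operations on words -/

section Words

variable {S : Type*} [Primcodable S]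

theorem primrec_invRev : Primrec (FreeGroup.invRev : Word S → Word S) :=
  Primrec.list_reverse.comp (Primrec.list_map Primrec.id
    ((Primrec.fst.pair (Primrec.not.comp Primrec.snd)).comp Primrec.snd).to₂)

/-- The concatenation of `n` copies of a word. -/
def powWord {S : Type*} (a : Word S) (n : ℕ) : Word S := n.rec [] fun _ w => a ++ w

theorem primrec_powWord : Primrec₂ (powWord : Word S → ℕ → Word S) :=
  Primrec.nat_rec (Primrec.const [])
    (Primrec.list_append.comp Primrec.fst (Primrec.snd.comp Primrec.snd)).to₂

theorem mk_powWord {S : Type*} (a : Word S) (n : ℕ) : FreeGroup.mk (powWord a n) = FreeGroup.mk a ^ n := by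
  induction n with
  | zero => exact FreeGroup.one_eq_mk.symm
  | succ n ih => rw [pow_succ', ← ih, FreeGroup.mul_mk]; rfl

end Words

/-! ### Reduction of cyclic membership to conjugacy -/

section Reduction

variable {X ι : Type*} [Primcodable X] [Primcodable ι] (R : ι → Word X)

/-- A word on `X` as a word on the generators of the Miller machine. -/
def genWord (ι : Type*) {X : Type*} (w : Word X) : Word (Gen X ι) :=
  w.map fun p => (Sum.inl p.1, p.2)

theorem primrec_genWord : Primrec (genWord ι : Word X → Word (Gen X ι)) :=
  Primrec.list_map Primrec.id
    (((Primrec.sumInl.comp Primrec.fst).pair Primrec.snd).comp Primrec.snd).to₂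

/-- The word consisting of the letter `q` or its inverse. -/
def qWord (X ι : Type*) (e : Bool) : Word (Gen X ι) := [(Sum.inr (Sum.inr ()), e)]

theorem val_append {S : Type*} (rels : Set (FreeGroup S)) (v w : Word S) :
    val rels (v ++ w) = val rels v * val rels w := by
  rw [val, ← FreeGroup.mul_mk, map_mul]; rfl

theorem val_genWord {X ι : Type*} (R : ι → Word X) (w : Word X) :
    val (millerRels R) (genWord ι w) = toM R (FreeGroup.mk w) := by
  rw [MonoidHom.comp_apply, FreeGroup.map.mk]; rfl

theorem val_qWord_true {X ι : Type*} (R : ι → Word X) :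
    val (millerRels R) (qWord X ι true) = qM R := rfl

theorem val_qWord_false {X ι : Type*} (R : ι → Word X) :
    val (millerRels R) (qWord X ι false) = (qM R)⁻¹ := by
  rw [qM, ← map_inv]; rfl

theorem computablePred_toG_eq_one (hconj : ConjugacyProblemSolvable (millerRels R)) :
    ComputablePred fun w : Word X => toG R (FreeGroup.mk w) = 1 := by
  have hf : Primrec fun w : Word X => (qWord X ι true ++ genWord ι w, qWord X ι true) :=
    (Primrec.list_append.comp (Primrec.const _) primrec_genWord).pair (Primrec.const _)
  refine (ComputablePred.comp hconj hf.to_comp).of_eq fun w => ?_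
  rw [val_append, val_genWord, val_qWord_true, isConj_qM_mul_iff]

/-- Once exponents are bounded computably, a finite search with the word problem of G decides; `baⁿ
= 1` and `ba⁻ⁿ = 1` cover both signs. -/
theorem cyclicSubgroupMembershipSolvable_of_bound
    (hconj : ConjugacyProblemSolvable (millerRels R)) (N : ℕ)
    (hN : ∀ (a b : Word X) (m : ℤ), toG R (FreeGroup.mk b) = toG R (FreeGroup.mk a) ^ m →
      ∃ m' : ℤ, m'.natAbs ≤ b.length + N ∧ toG R (FreeGroup.mk b) = toG R (FreeGroup.mk a) ^ m') :
    CyclicSubgroupMembershipSolvable (groupRels R) := by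
  have hW := computablePred_toG_eq_one R hconj
  have h₁ : Primrec fun x : (Word X × Word X) × ℕ => x.1.2 ++ powWord x.1.1 x.2 :=
    Primrec.list_append.comp (Primrec.snd.comp Primrec.fst)
      (primrec_powWord.comp (Primrec.fst.comp Primrec.fst) Primrec.snd)
  have h₂ : Primrec fun x : (Word X × Word X) × ℕ =>
      x.1.2 ++ powWord (FreeGroup.invRev x.1.1) x.2 :=
    Primrec.list_append.comp (Primrec.snd.comp Primrec.fst)
      (primrec_powWord.comp (primrec_invRev.comp (Primrec.fst.comp Primrec.fst)) Primrec.snd)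
  have h₃ : Primrec fun x : Word X × Word X => x.2.length + N + 1 :=
    Primrec.succ.comp (Primrec.nat_add.comp (Primrec.list_length.comp Primrec.snd)
      (Primrec.const N))
  refine (ComputablePred.exists_lt (p := fun x n =>
    toG R (FreeGroup.mk (x.2 ++ powWord x.1 n)) = 1 ∨
      toG R (FreeGroup.mk (x.2 ++ powWord (FreeGroup.invRev x.1) n)) = 1)
    ((hW.comp h₁.to_comp).or (hW.comp h₂.to_comp)) h₃.to_comp).of_eq ?_
  rintro ⟨a, b⟩
  simp only [← FreeGroup.mul_mk, mk_powWord, ← FreeGroup.inv_mk, map_mul, map_pow, map_inv,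
    mul_eq_one_iff_eq_inv, inv_pow, inv_inv, val]
  constructor
  · rintro ⟨n, -, h | h⟩
    · exact ⟨-n, by rw [zpow_neg, zpow_natCast]; exact h⟩
    · exact ⟨n, by rw [zpow_natCast]; exact h⟩
  · rintro ⟨m, hm⟩
    obtain ⟨m', hm', h⟩ := hN a b m hm
    refine ⟨m'.natAbs, by omega, ?_⟩
    obtain ⟨n, rfl | rfl⟩ := m'.eq_nat_or_neg
    · right; simpa using h
    · left; simpa using h

/-- The word `v * z ^ N * w * z ^ (-N)`, where `N` is large compared to the lengths of `v`, `w`. -/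
def properWord {X : Type*} (w : Word X) (z : X) (v : Word X) : Word X :=
  -- Only the length matters: 2(|v| + |w|) + 1, the extra letter making the inequality strict.
  let run : Word X := (v ++ v ++ (w ++ w ++ [(z, true)])).map fun _ => (z, true)
  v ++ (run ++ w ++ FreeGroup.invRev run)

theorem primrec_properWord (w : Word X) (z : X) : Primrec (properWord w z) := by
  have hrun : Primrec fun v : Word X =>
      (v ++ v ++ (w ++ w ++ [(z, true)])).map fun _ => (z, true) :=
    Primrec.list_map (Primrec.list_append.comp
      (Primrec.list_append.comp Primrec.id Primrec.id) (Primrec.const _)) (Primrec.const _).to₂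
  exact Primrec.list_append.comp Primrec.id
    (Primrec.list_append.comp (Primrec.list_append.comp hrun (Primrec.const w))
      (primrec_invRev.comp hrun))

theorem mk_properWord {X : Type*} (w : Word X) (z : X) (v : Word X) :
    ∃ N, 2 * (v.length + w.length) < N ∧ FreeGroup.mk (properWord w z v) = FreeGroup.mk v *
      (FreeGroup.of z ^ N * FreeGroup.mk w * (FreeGroup.of z ^ N)⁻¹) := by
  refine ⟨(v ++ v ++ (w ++ w ++ [(z, true)])).length, by simp; omega, ?_⟩
  rw [properWord, List.map_const', ← FreeGroup.mk_replicate, FreeGroup.inv_mk, FreeGroup.mul_mk,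
    FreeGroup.mul_mk, FreeGroup.mul_mk]

/-- The pair of words whose conjugacy in the Miller machine expresses, for a word `u` that is not a
proper power, that `b` is a power of `u` in `G`. -/
def testWords (ι : Type*) {X : Type*} (u b : Word X) : Word (Gen X ι) × Word (Gen X ι) :=
  (qWord X ι true ++ genWord ι u ++ qWord X ι false ++ genWord ι u,
    qWord X ι true ++ genWord ι (b ++ u ++ FreeGroup.invRev b) ++ qWord X ι false ++ genWord ι u)

theorem primrec_testWords :
    Primrec₂ (testWords ι : Word X → Word X → Word (Gen X ι) × Word (Gen X ι)) := by
  have key : ∀ f : Word X × Word X → Word X, Primrec f → Primrec fun p : Word X × Word X =>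
      qWord X ι true ++ genWord ι (f p) ++ qWord X ι false ++ genWord ι p.1 := fun f hf =>
    Primrec.list_append.comp
      (Primrec.list_append.comp
        (Primrec.list_append.comp (Primrec.const _) (primrec_genWord.comp hf)) (Primrec.const _))
      (primrec_genWord.comp Primrec.fst)
  exact (key _ Primrec.fst).pair (key (fun p => p.2 ++ p.1 ++ FreeGroup.invRev p.2)
    (Primrec.list_append.comp (Primrec.list_append.comp Primrec.snd Primrec.fst)
      (primrec_invRev.comp Primrec.snd)))

/-- The conjugacy test for `b` being a power of `properWord w z (a ++ s)`. -/
def Test {X ι : Type*} (R : ι → Word X) (w s : Word X) (z : X) (p : Word X × Word X) : Prop :=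
  IsConj (val (millerRels R) (testWords ι (properWord w z (p.1 ++ s)) p.2).1)
    (val (millerRels R) (testWords ι (properWord w z (p.1 ++ s)) p.2).2)

theorem computablePred_test (hconj : ConjugacyProblemSolvable (millerRels R)) (w s : Word X)
    (z : X) : ComputablePred (Test R w s z) := by
  have h : Primrec fun p : Word X × Word X => testWords ι (properWord w z (p.1 ++ s)) p.2 :=
    primrec_testWords.comp ((primrec_properWord w z).comp
      (Primrec.list_append.comp Primrec.fst (Primrec.const s))) Primrec.snd
  exact ComputablePred.comp hconj h.to_comp

theorem test_iff {X ι : Type*} (R : ι → Word X) (w s : Word X) (z : X) (a b : Word X) :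
    Test R w s z (a, b) ↔ IsConj
      (qM R * toM R (FreeGroup.mk (properWord w z (a ++ s))) * (qM R)⁻¹ *
        toM R (FreeGroup.mk (properWord w z (a ++ s))))
      (qM R * toM R (FreeGroup.mk b * FreeGroup.mk (properWord w z (a ++ s)) * (FreeGroup.mk b)⁻¹) *
        (qM R)⁻¹ * toM R (FreeGroup.mk (properWord w z (a ++ s)))) := by
  simp only [Test, testWords, val_append, val_genWord, val_qWord_true, val_qWord_false,
    FreeGroup.inv_mk, FreeGroup.mul_mk]

theorem toG_properWord {X ι : Type*} (R : ι → Word X) {w s : Word X}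
    (hw : toG R (FreeGroup.mk w) = 1) (hs : toG R (FreeGroup.mk s) = 1) (z : X) (a : Word X) :
    toG R (FreeGroup.mk (properWord w z (a ++ s))) = toG R (FreeGroup.mk a) := by
  obtain ⟨N, -, hN⟩ := mk_properWord w z (a ++ s)
  rw [hN, ← FreeGroup.mul_mk, map_mul, map_mul, map_mul, map_mul, hw, hs, mul_one, mul_one,
    ← map_mul, mul_inv_cancel, map_one, mul_one]

theorem test_of_eq_zpow {X ι : Type*} (R : ι → Word X) {w s : Word X}
    (hw : toG R (FreeGroup.mk w) = 1) (hs : toG R (FreeGroup.mk s) = 1) (z : X) {a b : Word X}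
    {m : ℤ} (h : toG R (FreeGroup.mk b) = toG R (FreeGroup.mk a) ^ m) : Test R w s z (a, b) :=
  (test_iff R w s z a b).2 (isConj_of_toG_eq_zpow R (by rw [toG_properWord R hw hs, h]))

theorem exists_eq_zpow_of_test {X ι : Type*} (R : ι → Word X) {w s : Word X}
    (hw : toG R (FreeGroup.mk w) = 1) (hs : toG R (FreeGroup.mk s) = 1) {z : X} {a b : Word X}
    (hwz : FreeGroup.mk w ∉ Subgroup.zpowers (FreeGroup.of z))
    (haz : FreeGroup.mk (a ++ s) ∉ Subgroup.zpowers (FreeGroup.of z))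
    (h : Test R w s z (a, b)) :
    ∃ m : ℤ, toG R (FreeGroup.mk b) = toG R (FreeGroup.mk a) ^ m := by
  obtain ⟨N, hlt, hN⟩ := mk_properWord w z (a ++ s)
  have := FreeGroup.mem_zpowers_of_commute_mul_conj haz hwz hlt
  rw [← hN] at this
  rw [← toG_properWord R hw hs z a]
  exact exists_toG_eq_zpow_of_isConj R this.1 this.2 ((test_iff R w s z a b).1 h)

theorem cyclicSubgroupMembershipSolvable_of_ne
    (hconj : ConjugacyProblemSolvable (millerRels R)) {x y : X} (hxy : x ≠ y) {i : ι}
    (hi : FreeGroup.mk (R i) ≠ 1) : CyclicSubgroupMembershipSolvable (groupRels R) := by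
  classical
  obtain ⟨w', hw', hwx, hwy⟩ := FreeGroup.exists_mem_notMem_zpowers hxy
    (N := Subgroup.normalClosure (groupRels R)) (Subgroup.subset_normalClosure ⟨i, rfl⟩) hi
  obtain ⟨w, rfl⟩ : ∃ w, FreeGroup.mk w = w' := ⟨w'.toWord, FreeGroup.mk_toWord⟩
  have hw : toG R (FreeGroup.mk w) = 1 := PresentedGroup.mk_eq_one_iff.2 hw'
  have hnil : toG R (FreeGroup.mk []) = 1 := map_one _
  -- Every test holds when b is a power of a in G, so the conjunction loses nothing, and at least
  -- one test is conclusive: if a is not a power of `x`, or not of `y`, one of the first two;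
  -- otherwise a = 1 in F, and the third replaces a by aw, which is `w`.
  refine (((computablePred_test R hconj w [] x).and (computablePred_test R hconj w [] y)).and
    (computablePred_test R hconj w w x)).of_eq ?_
  rintro ⟨a, b⟩
  constructor
  · rintro ⟨⟨h₁, h₂⟩, h₃⟩
    by_cases hx : FreeGroup.mk a ∈ Subgroup.zpowers (FreeGroup.of x)
    · by_cases hy : FreeGroup.mk a ∈ Subgroup.zpowers (FreeGroup.of y)
      · have ha := FreeGroup.eq_one_of_mem_zpowers_of_mem_zpowers hxy hx hy
        exact exists_eq_zpow_of_test R hw hw hwx (by rwa [← FreeGroup.mul_mk, ha, one_mul]) h₃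
      · exact exists_eq_zpow_of_test R hw hnil hwy (by rwa [List.append_nil]) h₂
    · exact exists_eq_zpow_of_test R hw hnil hwx (by rwa [List.append_nil]) h₁
  · rintro ⟨m, hm⟩
    exact ⟨⟨test_of_eq_zpow R hw hnil x hm, test_of_eq_zpow R hw hnil y hm⟩,
      test_of_eq_zpow R hw hw x hm⟩

/-- Here G is free, and the length of a power of a nontrivial element bounds the exponent. -/
theorem cyclicSubgroupMembershipSolvable_of_forall_eq_one
    (hconj : ConjugacyProblemSolvable (millerRels R)) (h : ∀ i, FreeGroup.mk (R i) = 1) :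
    CyclicSubgroupMembershipSolvable (groupRels R) := by
  classical
  have hinj : Function.Injective (toG R) := by
    refine (injective_iff_map_eq_one _).2 fun g hg => ?_
    have : Subgroup.normalClosure (groupRels R) ≤ ⊥ :=
      Subgroup.normalClosure_le_normal (by rintro _ ⟨i, rfl⟩; exact h i)
    exact this (PresentedGroup.mk_eq_one_iff.1 hg)
  refine cyclicSubgroupMembershipSolvable_of_bound R hconj 0 fun a b m hm => ?_
  by_cases ha : FreeGroup.mk a = 1
  · exact ⟨0, by simp, by rw [hm, ha, map_one, one_zpow, one_zpow]⟩
  · refine ⟨m, ?_, hm⟩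
    rw [← map_zpow] at hm
    calc m.natAbs ≤ FreeGroup.norm (FreeGroup.mk a ^ m) := FreeGroup.natAbs_le_norm_zpow ha m
      _ = FreeGroup.norm (FreeGroup.mk b) := by rw [hinj hm]
      _ ≤ b.length := FreeGroup.norm_mk_le

theorem cyclicSubgroupMembershipSolvable_of_subsingleton [Subsingleton X]
    (hconj : ConjugacyProblemSolvable (millerRels R)) {i : ι} (hi : FreeGroup.mk (R i) ≠ 1) :
    CyclicSubgroupMembershipSolvable (groupRels R) := by
  obtain ⟨p, l, hpl⟩ := List.exists_cons_of_ne_nil (l := R i)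
    fun h => hi (by rw [h, FreeGroup.one_eq_mk])
  obtain ⟨s, hs⟩ := FreeGroup.exists_eq_zpow_of_subsingleton p.1 (FreeGroup.mk (R i))
  have hs₀ : s ≠ 0 := by
    rintro rfl
    exact hi (by rw [hs, zpow_zero])
  refine cyclicSubgroupMembershipSolvable_of_bound R hconj s.natAbs fun a b m hm => ?_
  obtain ⟨k, hk⟩ := FreeGroup.exists_eq_zpow_of_subsingleton p.1 (FreeGroup.mk a)
  have ha : toG R (FreeGroup.mk a) ^ s = 1 := by
    rw [hk, ← map_zpow, ← zpow_mul, mul_comm, zpow_mul, ← hs, map_zpow, toG_relator, one_zpow]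
  -- All elements have exponent dividing `s` in G, so `m` matters only modulo `s`.
  refine ⟨m % s, ?_, ?_⟩
  · have := Int.emod_nonneg m hs₀
    have := Int.emod_lt_abs m hs₀
    rw [Int.abs_eq_natAbs] at this
    omega
  · rw [hm]
    conv_lhs => rw [← Int.emod_add_mul_ediv m s, zpow_add, zpow_mul, ha, one_zpow, mul_one]

end Reduction

end Miller

theorem mainTheorem6 {X ι : Type*} [Finite X] [Finite ι] [Primcodable X] [Primcodable ι]
    (R : ι → Miller.Word X)
    (hconj : Miller.ConjugacyProblemSolvable (Miller.millerRels R)) :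
    Miller.CyclicSubgroupMembershipSolvable (Miller.groupRels R) := by
  by_cases h : ∀ i, FreeGroup.mk (R i) = 1
  · exact Miller.cyclicSubgroupMembershipSolvable_of_forall_eq_one R hconj h
  push Not at h
  obtain ⟨i, hi⟩ := h
  rcases subsingleton_or_nontrivial X with hX | hX
  · exact Miller.cyclicSubgroupMembershipSolvable_of_subsingleton R hconj hi
  · obtain ⟨x, y, hxy⟩ := exists_pair_ne X
    exact Miller.cyclicSubgroupMembershipSolvable_of_ne R hconj hxy hi
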